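/- Graphs are finite and may have loops and multiple edges. A signed graph is a graph $G$ together with a signature $\sigma:E(G)\to\{1,-1\}$. Every edge $e$ consists of two half-edges $h,\hat h$, each incident with one end of $e$ (both with the same vertex if $e$ is a loop); write $e_h$ for the edge containing the half-edge $h$. An orientation of $(G,\sigma)$ is a map $\tau$ from the set of half-edges to $\{1,-1\}$ such that $\tau(h)\tau(\hat h)=-\sigma(e_h)$ for every half-edge $h$. For an abelian group $A$, a nowhere-zero $A$-flow ($A$-NZF) of $(G,\sigma)$ is a pair $(\tau,f)$ of an orientation $\tau$ and a map $f:E(G)\to A\setminus\{0\}$ such that $\sum_{h\text{ at }v}\tau(h)f(e_h)=0$ for every vertex $v$, where the sum runs over the half-edges incident with $v$. A nowhere-zero $k$-flow ($k$-NZF) is a nowhere-zero $\mathbb Z$-flow $(\tau,f)$ with $|f(e)|<k$ for every edge $e$. An edge $e$ is a cut-edge of $G$ if its ends lie in different components of $G-e$. **Theorem.** Let $G$ be a signed graph that admits a $\mathbb Z_3$-NZF. Then $G$ admits a $5$-NZF $(\tau,g)$ such that no edge $e$ has $|g(e)|=3$, and every edge $e$ with $|g(e)|=4$ is a cut-edge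 of $G$. -/

import Mathlib

/-- A signed graph with vertex type `V` and edge type `E`; multiple edges and loops are allowed.
Every edge `e` consists of the two half-edges `(e, false)` and `(e, true)`; the half-edge `h` is
incident with the vertex `inc h`. The edge `e` is a loop if the ends of its two half-edges agree.
The signature takes values in `ℤˣ = {1, -1}`. -/
structure SignedGraph (V : Type*) (E : Type*) where
  inc : E × Bool → V
  sign : E → ℤˣ

namespace SignedGraph

/-- An orientation: `τ h = 1` means that `h` points away from its end, `τ h = -1` towards it. -/
def IsOrientation {V E : Type*} (G : SignedGraph V E) (τ : E × Bool → ℤˣ) : Prop :=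
  ∀ (e : E) (b : Bool), τ (e, b) * τ (e, !b) = -G.sign e

/-- The boundary at `v`: the sum of `τ h • f (edge of h)` over the half-edges `h` at `v`. -/
def boundary {V E : Type*} [DecidableEq V] [Fintype E] {A : Type*} [AddCommGroup A]
    (G : SignedGraph V E) (τ : E × Bool → ℤˣ) (f : E → A) (v : V) : A :=
  ∑ h : E × Bool with G.inc h = v, (τ h : ℤ) • f h.1

/-- The pair `(τ, f)` is an `A`-flow of `G`. -/
def IsFlow {V E : Type*} [DecidableEq V] [Fintype E] {A : Type*} [AddCommGroup A]
    (G : SignedGraph V E) (τ : E × Bool → ℤˣ) (f : E → A) : Prop :=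
  G.IsOrientation τ ∧ ∀ v, G.boundary τ f v = 0

/-- The pair `(τ, f)` is a nowhere-zero `A`-flow of `G`. -/
def IsNZF {V E : Type*} [DecidableEq V] [Fintype E] {A : Type*} [AddCommGroup A]
    (G : SignedGraph V E) (τ : E × Bool → ℤˣ) (f : E → A) : Prop :=
  G.IsFlow τ f ∧ ∀ e, f e ≠ 0

/-- The pair `(τ, f)` is a nowhere-zero (integer) `k`-flow of `G`. -/
def IsIntNZF {V E : Type*} [DecidableEq V] [Fintype E]
    (G : SignedGraph V E) (k : ℕ) (τ : E × Bool → ℤˣ) (f : E → ℤ) : Prop :=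
  G.IsNZF τ f ∧ ∀ e, |f e| < (k : ℤ)

/-- `u` and `v` are the two ends of an edge other than `e`. -/
def AdjAvoiding {V E : Type*} (G : SignedGraph V E) (e : E) (u v : V) : Prop :=
  ∃ (e' : E) (b : Bool), e' ≠ e ∧ G.inc (e', b) = u ∧ G.inc (e', !b) = v

/-- The set of cut-edges (bridges): `e` is a cut-edge if its ends lie in different components of
`G - e`, that is, no walk of `G - e` joins them. -/
def cutEdges {V E : Type*} (G : SignedGraph V E) : Set E :=
  {e | ¬ Relation.ReflTransGen (G.AdjAvoiding e) (G.inc (e, false)) (G.inc (e, true))}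

/-- The set of edges on which the integer function `f` has the value `t` or `-t`. -/
def edgesOfAbs {E : Type*} (f : E → ℤ) (t : ℕ) : Set E :=
  {e | |f e| = (t : ℤ)}

end SignedGraph

/-! Reversing the edges with flow value -1 turns the `ZMod 3`-flow into the constant 1, so the
all-one integer function has boundary `3d`. An integer flow with values 1 and -2 is then `1 - 3 *
1_S` for an edge set `S` with boundary `d`; switching at vertices replaces `d` by `n = |d|`.

Such an `S` is read off a perfect matching of a gadget graph: at each vertex `v`, the outgoing
half-edges are joined completely to the ingoing ones together with `2 * n v` core vertices, and the
two half-edges of an edge are joined as mates. `S` consists of the edges whose half-edges are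
matched to each other. If no edge cut has size one, the gadget has a perfect matching by Tutte's
theorem: a fractional perfect matching with weight 1/3 on mate pairs sends weight at least 1 from
each odd component to the deleted set (`one_le_sum_gadgetEdgeWeight`).

Cut-edges are first replaced by three parallel copies, one of them reversed. This destroys cuts of
size one and keeps the boundary of the all-one function. Recombining the copies gives a value in {1,
4, -2, -5}, and flow values on cut-edges are even, which leaves -2 and 4. -/

open Finset

/-! ### Tutte's condition from a fractional perfect matching -/

/-- A weighted sufficient condition for perfect matchings: all vertices have weighted degree one
and every odd set which is a union of components after deleting `U` sends weight one to `U`. -/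
theorem SimpleGraph.exists_isPerfectMatching_of_weight {Y : Type*} [Fintype Y] [DecidableEq Y]
    (H : SimpleGraph Y) (w : Y → Y → ℚ) (hw : ∀ y z, 0 ≤ w y z) (hone : ∀ z, ∑ y, w y z = 1)
    (hodd : ∀ C U : Finset Y, Disjoint C U → Odd C.card →
      (∀ y ∈ C, ∀ z, z ∉ U → H.Adj y z → z ∈ C) → 1 ≤ ∑ y ∈ C, ∑ z ∈ U, w y z) :
    ∃ M : H.Subgraph, M.IsPerfectMatching := by
  classical
  rw [SimpleGraph.tutte]
  intro u hu
  set K := ((⊤ : H.Subgraph).deleteVerts u).coe with hK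
  -- Double counting: each odd component sends weight at least 1 into `u`, and each vertex of `u`
  -- receives total weight 1.
  have key : (K.oddComponents.ncard : ℚ) ≤ u.ncard := by
    rw [Set.ncard_eq_toFinset_card', Set.ncard_eq_toFinset_card']
    let S : K.ConnectedComponent → Finset Y := fun c => (Subtype.val '' c.supp).toFinset
    have hSmem : ∀ c y, y ∈ S c ↔ ∃ h : y ∈ ((⊤ : H.Subgraph).deleteVerts u).verts,
        K.connectedComponentMk ⟨y, h⟩ = c := by
      intro c y
      simp [S]
    have hdisj : ∀ c ∈ K.oddComponents.toFinset, ∀ d ∈ K.oddComponents.toFinset, c ≠ d →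
        Disjoint (S c) (S d) := by
      intro c _ d _ hcd
      rw [Finset.disjoint_left]
      intro y hc hd
      obtain ⟨h1, h2⟩ := (hSmem c y).1 hc
      obtain ⟨h3, h4⟩ := (hSmem d y).1 hd
      exact hcd (h2.symm.trans h4)
    calc (K.oddComponents.toFinset.card : ℚ) = ∑ c ∈ K.oddComponents.toFinset, 1 := by simp
      _ ≤ ∑ c ∈ K.oddComponents.toFinset, ∑ y ∈ S c, ∑ z ∈ u.toFinset, w y z := by
        refine Finset.sum_le_sum fun c hc => hodd _ _ ?_ ?_ ?_
        · rw [Finset.disjoint_left]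
          intro y hy hyu
          obtain ⟨h1, -⟩ := (hSmem c y).1 hy
          simp at h1 hyu
          exact h1 hyu
        · have h1 : Odd c.supp.ncard := by simpa using hc
          rw [← Set.ncard_image_of_injective c.supp Subtype.val_injective] at h1
          rwa [Set.ncard_eq_toFinset_card'] at h1
        · intro y hy z hz hyz
          obtain ⟨h1, h2⟩ := (hSmem c y).1 hy
          have hz' : z ∈ ((⊤ : H.Subgraph).deleteVerts u).verts := by simpa using hz
          refine (hSmem c z).2 ⟨hz', ?_⟩
          rw [← h2, SimpleGraph.ConnectedComponent.eq]
          refine SimpleGraph.Adj.reachable ?_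
          simp only [hK, SimpleGraph.Subgraph.coe_adj, SimpleGraph.Subgraph.deleteVerts_adj]
          simp at h1 hz'
          simp [h1, hz', hyz.symm]
      _ = ∑ y ∈ K.oddComponents.toFinset.biUnion S, ∑ z ∈ u.toFinset, w y z :=
        (Finset.sum_biUnion hdisj).symm
      _ ≤ ∑ y, ∑ z ∈ u.toFinset, w y z :=
        Finset.sum_le_sum_of_subset_of_nonneg (Finset.subset_univ _)
          fun y _ _ => Finset.sum_nonneg fun z _ => hw y z
      _ = u.toFinset.card := by rw [Finset.sum_comm]; simp [hone]
  have hu' : u.ncard < K.oddComponents.ncard := hu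
  exact absurd key (not_le.2 (by exact_mod_cast hu'))

/-! ### Cut weights in weighted complete bipartite graphs -/

/-- The cut weight of a weighted complete bipartite graph, when one side contains an element of
weight one inside `C` and one outside of `C`. -/
theorem le_bipartite_cut_of_split {W a a' b b' : ℚ} (hW : 2 ≤ W) (ha : 0 ≤ a) (ha0 : 0 ≤ a')
    (hb : 1 ≤ b) (hbW : b + 1 ≤ W) (haa : a + a' = W) (hbb : 0 < a → b + b' = W) :
    W ≤ a * b' + b * a' := by
  rcases ha.eq_or_lt with h | h
  · subst h
    have : a' = W := by linarith
    subst this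
    nlinarith
  -- The excess over `W` is `a * (W - b - 1) + (b - 1) * (W - a)`.
  · obtain rfl : b' = W - b := by linarith [hbb h]
    obtain rfl : a' = W - a := by linarith
    nlinarith [mul_nonneg ha (sub_nonneg.2 hbW), mul_nonneg ha0 (sub_nonneg.2 hb)]

/-- The cut weight of a weighted complete bipartite graph whose vertices have weight at least
`2 / 3`, when the cut is not trivial. -/
theorem le_bipartite_cut_of_proper {W a a' b b' : ℚ}
    (ha : a = 0 ∨ 2 / 3 ≤ a) (hb : b = 0 ∨ 2 / 3 ≤ b)
    (ha' : a' = 0 ∨ 2 / 3 ≤ a') (hb' : b' = 0 ∨ 2 / 3 ≤ b')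
    (haa : 0 < b → a + a' = W) (hbb : 0 < a → b + b' = W)
    (h0 : 0 < a ∨ 0 < b) (h1 : a = W → b = W → False) :
    2 / 3 * W ≤ a * b' + b * a' := by
  have h23 : (0 : ℚ) < 2 / 3 := by norm_num
  rcases ha with rfl | ha
  · have hb0 : 0 < b := by simpa using h0
    have := haa hb0
    rcases hb with rfl | hb
    · simp at hb0
    rcases ha' with rfl | ha'
    · simp at this; subst this; simp
    · obtain rfl : a' = W := by linarith
      nlinarith
  · have hW := hbb (h23.trans_le ha)
    rcases hb with rfl | hb
    · rcases hb' with rfl | hb'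
      · simp at hW; subst hW; simp
      · obtain rfl : b' = W := by linarith
        nlinarith
    · have hW' := haa (h23.trans_le hb)
      rcases ha' with rfl | ha' <;> rcases hb' with rfl | hb'
      · exact (h1 (by linarith) (by linarith)).elim
      · obtain rfl : a = W := by linarith
        nlinarith
      · obtain rfl : b = W := by linarith
        nlinarith
      -- Expanding `(a - 2/3) * (b' - 2/3) + (b - 2/3) * (a' - 2/3) ≥ 0` bounds the cut below by
      -- `4/3 * W - 8/9`, and `W ≥ 4/3`.
      · obtain rfl : b' = W - b := by linarith
        obtain rfl : a' = W - a := by linarith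
        nlinarith [mul_nonneg (sub_nonneg.2 ha) (sub_nonneg.2 hb'),
          mul_nonneg (sub_nonneg.2 hb) (sub_nonneg.2 ha')]

section SideMass

variable {V Y : Type*} [DecidableEq V]

/-- The total weight of the elements of `F` located at `v` on side `s`. -/
def sideMass (loc : Y → V) (side : Y → Bool) (β : Y → ℚ) (F : Finset Y) (v : V) (s : Bool) : ℚ :=
  ∑ y ∈ F with (loc y = v ∧ side y = s), β y

variable {loc : Y → V} {side : Y → Bool} {β : Y → ℚ}

theorem sideMass_eq_zero_or_le (hβ : ∀ y, 2 / 3 ≤ β y) (F : Finset Y) (v : V) (s : Bool) :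
    sideMass loc side β F v s = 0 ∨ 2 / 3 ≤ sideMass loc side β F v s := by
  unfold sideMass
  rcases (F.filter fun y => loc y = v ∧ side y = s).eq_empty_or_nonempty with h | ⟨y, hy⟩
  · left; rw [h, sum_empty]
  · right
    exact (hβ y).trans (single_le_sum (f := β) (fun z _ => by linarith [hβ z]) hy)

theorem le_sideMass (hβ : ∀ y, 0 ≤ β y) {F : Finset Y} {y : Y} (hy : y ∈ F) :
    β y ≤ sideMass loc side β F (loc y) (side y) :=
  single_le_sum (f := β) (fun z _ => hβ z) (by simp [hy])

theorem sideMass_nonneg (hβ : ∀ y, 0 ≤ β y) (F : Finset Y) (v : V) (s : Bool) :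
    0 ≤ sideMass loc side β F v s :=
  sum_nonneg fun z _ => hβ z

theorem exists_of_sideMass_pos {F : Finset Y} {v : V} {s : Bool}
    (h : 0 < sideMass loc side β F v s) : ∃ y ∈ F, loc y = v ∧ side y = s := by
  obtain ⟨y, hy, -⟩ := exists_ne_zero_of_sum_ne_zero h.ne'
  rw [mem_filter] at hy
  exact ⟨y, hy⟩

variable [Fintype Y]

theorem sideMass_add_eq [DecidableEq Y] {C U : Finset Y} (hd : Disjoint C U) {v : V} {s : Bool}
    (h : ∀ y, loc y = v → side y = s → y ∈ C ∨ y ∈ U) :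
    sideMass loc side β C v s + sideMass loc side β U v s = sideMass loc side β univ v s := by
  unfold sideMass
  rw [← sum_union (disjoint_filter_filter hd), ← filter_union]
  refine sum_congr ?_ fun _ _ => rfl
  ext y
  simp only [mem_filter, mem_union, mem_univ, true_and, and_iff_right_iff_imp, and_imp]
  exact h y

theorem sideMass_add_le [DecidableEq Y] (hβ : ∀ y, 0 ≤ β y) {F : Finset Y} {y : Y} (hy : y ∉ F) :
    sideMass loc side β F (loc y) (side y) + β y ≤ sideMass loc side β univ (loc y) (side y) := by
  have h : y ∉ F.filter fun z => loc z = loc y ∧ side z = side y := by simp [hy]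
  unfold sideMass
  rw [add_comm, ← sum_insert (f := β) h]
  refine sum_le_sum_of_subset_of_nonneg ?_ fun z _ _ => hβ z
  intro z
  simp only [mem_insert, mem_filter, mem_univ, true_and]
  rintro (rfl | h)
  exacts [⟨rfl, rfl⟩, h.2]

omit [Fintype Y] in
theorem sum_sum_bipartite [Fintype V] (W : V → ℚ) (C U : Finset Y) :
    ∑ y ∈ C, ∑ z ∈ U, (if loc y = loc z ∧ side y ≠ side z then β y * β z / W (loc y) else 0) =
      ∑ v, (sideMass loc side β C v true * sideMass loc side β U v false +
        sideMass loc side β C v false * sideMass loc side β U v true) / W v := by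
  simp only [sideMass, sum_filter, sum_mul_sum, ← sum_add_distrib, sum_div]
  symm
  rw [sum_comm]
  refine sum_congr rfl fun y _ => ?_
  rw [sum_comm]
  refine sum_congr rfl fun z _ => ?_
  rw [sum_eq_single (loc y)]
  · by_cases h : loc z = loc y
    · cases h1 : side y <;> cases h2 : side z <;> simp [h]
    · have h' : ¬ loc y = loc z := fun e => h e.symm
      simp [h, h']
  · intro v _ hv
    simp [hv.symm]
  · simp

end SideMass

/-! ### The matching gadget and its side weights -/

namespace SignedGraph

variable {V E : Type*}

/-- The vertices of the matching gadget: the half-edges, and `2 * n v` core vertices at `v`. -/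
abbrev GadgetVertex (E : Type*) (n : V → ℕ) := (E × Bool) ⊕ (Σ v, Fin (2 * n v))

/-- The position of a gadget vertex. -/
def gadgetLoc (inc : E × Bool → V) (n : V → ℕ) : GadgetVertex E n → V := Sum.elim inc Sigma.fst

/-- The side of a gadget vertex in the complete bipartite graph at its position. -/
def gadgetSide (t : E × Bool → Bool) (n : V → ℕ) : GadgetVertex E n → Bool :=
  Sum.elim t fun _ => false

/-- The weight of a gadget vertex inside the complete bipartite graph at its position. -/
def gadgetWeight (n : V → ℕ) : GadgetVertex E n → ℚ := Sum.elim (fun _ => 2 / 3) fun _ => 1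

/-- The two half-edges of an edge are mates. -/
def GadgetMate (n : V → ℕ) : GadgetVertex E n → GadgetVertex E n → Prop
  | .inl h, .inl k => k = (h.1, !h.2)
  | _, _ => False

/-- The gadget graph: its perfect matchings describe the edge sets with prescribed boundary. -/
def gadget (inc : E × Bool → V) (t : E × Bool → Bool) (n : V → ℕ) :
    SimpleGraph (GadgetVertex E n) where
  Adj y z := GadgetMate n y z ∨
    gadgetLoc inc n y = gadgetLoc inc n z ∧ gadgetSide t n y ≠ gadgetSide t n z
  symm := ⟨by
    rintro y z (h | ⟨h1, h2⟩)
    · left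
      rcases y with ⟨e, b⟩ | y <;> rcases z with ⟨e', b'⟩ | z <;> simp_all [GadgetMate]
    · exact Or.inr ⟨h1.symm, h2.symm⟩⟩
  loopless := ⟨by
    rintro y (h | ⟨-, h2⟩)
    · rcases y with ⟨e, b⟩ | y <;> simp [GadgetMate] at h
    · exact h2 rfl⟩

theorem gadgetWeight_ge (n : V → ℕ) (y : GadgetVertex E n) : 2 / 3 ≤ gadgetWeight n y := by
  rcases y with y | y <;> norm_num [gadgetWeight]

theorem gadgetWeight_nonneg (n : V → ℕ) (y : GadgetVertex E n) : 0 ≤ gadgetWeight n y := by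
  linarith [gadgetWeight_ge n y]

section Mass

variable [Fintype V] [DecidableEq V] [Fintype E] (inc : E × Bool → V) (t : E × Bool → Bool)
  (n : V → ℕ)

/-- The weight of one side of the complete bipartite graph at `v`. -/
def gadgetTotal (v : V) : ℚ := 2 / 3 * #{h | inc h = v ∧ t h = true}

omit [Fintype V] in
theorem sum_gadgetWeight_inl (v : V) (s : Bool) :
    (∑ h, if gadgetLoc inc n (.inl h) = v ∧ gadgetSide t n (.inl h) = s
      then gadgetWeight n (.inl h) else 0) = 2 / 3 * #{h | inc h = v ∧ t h = s} := by
  rw [card_filter]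
  push_cast
  rw [mul_sum]
  refine sum_congr rfl fun h _ => ?_
  change (if inc h = v ∧ t h = s then (2 / 3 : ℚ) else 0) = _
  split_ifs <;> simp

theorem sideMass_gadget_true (v : V) :
    sideMass (gadgetLoc inc n) (gadgetSide t n) (gadgetWeight n) univ v true =
      gadgetTotal inc t v := by
  rw [sideMass, sum_filter, Fintype.sum_sum_type, sum_gadgetWeight_inl]
  simp [gadgetTotal, gadgetLoc, gadgetSide]

variable {inc t n}

/-- The `2 * n v` core vertices of weight 1 make up exactly for the surplus of `3 * n v` half-edges
of weight 2/3 on the other side. -/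
theorem sideMass_gadget_false
    (hn : ∀ v, #{h | inc h = v ∧ t h = true} = #{h | inc h = v ∧ t h = false} + 3 * n v) (v : V) :
    sideMass (gadgetLoc inc n) (gadgetSide t n) (gadgetWeight n) univ v false =
      gadgetTotal inc t v := by
  have h1 : sideMass (gadgetLoc inc n) (gadgetSide t n) (gadgetWeight n) univ v false =
      2 / 3 * #{h | inc h = v ∧ t h = false} + 2 * n v := by
    rw [sideMass, sum_filter, Fintype.sum_sum_type, sum_gadgetWeight_inl,
      Fintype.sum_sigma]
    simp [gadgetLoc, gadgetSide, gadgetWeight, mul_comm]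
  rw [h1, gadgetTotal, hn v]
  push_cast
  ring

theorem sideMass_gadget
    (hn : ∀ v, #{h | inc h = v ∧ t h = true} = #{h | inc h = v ∧ t h = false} + 3 * n v) (v : V)
    (s : Bool) : sideMass (gadgetLoc inc n) (gadgetSide t n) (gadgetWeight n) univ v s =
      gadgetTotal inc t v := by
  cases s
  exacts [sideMass_gadget_false hn v, sideMass_gadget_true inc t n v]

theorem gadgetTotal_pos
    (hn : ∀ v, #{h | inc h = v ∧ t h = true} = #{h | inc h = v ∧ t h = false} + 3 * n v)
    (y : GadgetVertex E n) : 0 < gadgetTotal inc t (gadgetLoc inc n y) := by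
  have h1 := le_sideMass (loc := gadgetLoc inc n) (side := gadgetSide t n)
    (gadgetWeight_nonneg n) (mem_univ y)
  rw [sideMass_gadget hn] at h1
  linarith [gadgetWeight_ge n y]

omit [Fintype V] in
theorem gadgetTotal_nonneg (v : V) : 0 ≤ gadgetTotal inc t v := by
  unfold gadgetTotal; positivity

end Mass

end SignedGraph

theorem Finset.sum_eq_sum_ite_mem {Y M : Type*} [Fintype Y] [DecidableEq Y] [AddCommMonoid M]
    (C : Finset Y) (f : Y → M) : ∑ y ∈ C, f y = ∑ y, if y ∈ C then f y else 0 := by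
  simp

/-! ### The fractional perfect matching -/

namespace SignedGraph

variable {V E : Type*}

/-- The edge weights of the gadget graph. -/
noncomputable def gadgetEdgeWeight [DecidableEq V] [Fintype E] (inc : E × Bool → V) (t : E × Bool → Bool)
    (n : V → ℕ) (y z : GadgetVertex E n) : ℚ :=
  (open Classical in if GadgetMate n y z then 1 / 3 else 0) +
    if gadgetLoc inc n y = gadgetLoc inc n z ∧ gadgetSide t n y ≠ gadgetSide t n z then
      gadgetWeight n y * gadgetWeight n z / gadgetTotal inc t (gadgetLoc inc n y) else 0

section

variable [Fintype V] [DecidableEq V] [Fintype E] {inc : E × Bool → V} {t : E × Bool → Bool}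
  {n : V → ℕ}

omit [Fintype V] in
theorem gadgetEdgeWeight_nonneg (y z : GadgetVertex E n) :
    0 ≤ gadgetEdgeWeight inc t n y z := by
  unfold gadgetEdgeWeight
  refine add_nonneg (by split_ifs <;> norm_num) ?_
  split_ifs
  · refine div_nonneg (mul_nonneg (gadgetWeight_nonneg n y) (gadgetWeight_nonneg n z)) ?_
    unfold gadgetTotal
    positivity
  · exact le_rfl

open Classical in
theorem sum_mate (C U : Finset (GadgetVertex E n)) :
    ∑ y ∈ C, ∑ z ∈ U, (if GadgetMate n y z then (1 / 3 : ℚ) else 0) =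
      ∑ e, ((if .inl (e, true) ∈ C ∧ .inl (e, false) ∈ U then 1 / 3 else 0) +
        if .inl (e, false) ∈ C ∧ .inl (e, true) ∈ U then 1 / 3 else 0) := by
  have h1 : ∀ h : E × Bool, ∑ z ∈ U, (if GadgetMate n (.inl h) z then (1 / 3 : ℚ) else 0) =
      if .inl (h.1, !h.2) ∈ U then 1 / 3 else 0 := by
    intro h
    rw [← sum_ite_eq' U (.inl (h.1, !h.2)) fun _ => (1 / 3 : ℚ)]
    refine sum_congr rfl fun z _ => ?_
    rcases z with z | z <;> simp [GadgetMate]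
  have h2 : ∀ c, ∑ z ∈ U, (if GadgetMate n (.inr c) z then (1 / 3 : ℚ) else 0) = 0 := by
    intro c
    exact sum_eq_zero fun z _ => by simp [GadgetMate]
  rw [sum_eq_sum_ite_mem C, Fintype.sum_sum_type, Fintype.sum_prod_type]
  simp only [h1, h2, Fintype.sum_bool]
  simp [ite_and]

/-- The product weights `β y * β z / W` distribute exactly `β z` at `z`, because the opposite side
has total `W`. A half-edge gets its missing 1/3 from its mate. The half-edges of a loop may be
adjacent in both ways, and then the two weights add up. -/
theorem sum_gadgetEdgeWeight
    (hn : ∀ v, #{h | inc h = v ∧ t h = true} = #{h | inc h = v ∧ t h = false} + 3 * n v)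
    (z : GadgetVertex E n) : ∑ y, gadgetEdgeWeight inc t n y z = 1 := by
  classical
  have h1 : ∑ y, (if GadgetMate n y z then (1 / 3 : ℚ) else 0) = 1 - gadgetWeight n z := by
    rcases z with ⟨e, b⟩ | c
    · rw [sum_eq_single (.inl (e, !b))]
      · simp [GadgetMate, gadgetWeight]; norm_num
      · rintro (⟨e', b'⟩ | c) _ h
        · rw [if_neg]
          rintro h'
          simp only [GadgetMate, Prod.mk.injEq] at h'
          obtain ⟨rfl, rfl⟩ := h'
          simp at h
        · simp [GadgetMate]
      · simp
    · rw [sum_eq_zero]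
      · simp [gadgetWeight]
      · rintro (y | y) _ <;> simp [GadgetMate]
  have h2 := sum_sum_bipartite (loc := gadgetLoc inc n) (side := gadgetSide t n)
    (β := gadgetWeight n) (gadgetTotal inc t) univ {z}
  simp only [sum_singleton] at h2
  have h3 : ∀ v s, sideMass (gadgetLoc inc n) (gadgetSide t n) (gadgetWeight n) {z} v s =
      if gadgetLoc inc n z = v ∧ gadgetSide t n z = s then gadgetWeight n z else 0 := by
    intro v s
    rw [sideMass, sum_filter, sum_singleton]
  unfold gadgetEdgeWeight
  rw [sum_add_distrib, h1, h2, sum_eq_single (gadgetLoc inc n z)]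
  · rw [sideMass_gadget hn, sideMass_gadget hn, h3, h3]
    have := (gadgetTotal_pos hn z).ne'
    cases gadgetSide t n z <;> simp <;> field_simp <;> ring
  · intro v _ hv
    simp [h3, hv.symm]
  · simp

-- Modulo 2, unsplit cores contribute nothing, being of even size `2 * n v`, and an edge contributes
-- exactly when one of its two half-edges lies in `C`.
open Classical in
theorem odd_card_cut {C : Finset (GadgetVertex E n)} (hodd : Odd C.card)
    (hcore : ∀ v (i j : Fin (2 * n v)), .inr ⟨v, i⟩ ∈ C → .inr ⟨v, j⟩ ∈ C) :
    Odd #{e : E | ¬ (Sum.inl (e, true) ∈ C ↔ Sum.inl (e, false) ∈ C)} := by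
  have h1 : C.card = ∑ e, ((if .inl (e, true) ∈ C then 1 else 0) +
      if .inl (e, false) ∈ C then 1 else 0) +
      ∑ v, ∑ i : Fin (2 * n v), if .inr ⟨v, i⟩ ∈ C then 1 else 0 := by
    rw [card_eq_sum_ones, sum_eq_sum_ite_mem C, Fintype.sum_sum_type, Fintype.sum_prod_type,
      Fintype.sum_sigma]
    simp only [Fintype.sum_bool]
  have h2 : ∀ v, ((∑ i : Fin (2 * n v), if .inr ⟨v, i⟩ ∈ C then 1 else 0 : ℕ) : ZMod 2) = 0 := by
    intro v
    by_cases h : ∃ i : Fin (2 * n v), .inr ⟨v, i⟩ ∈ C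
    · obtain ⟨i, hi⟩ := h
      rw [sum_congr rfl fun j _ => if_pos (hcore v i j hi)]
      simp
      left
      rfl
    · push Not at h
      rw [sum_congr rfl fun j _ => if_neg (h j)]
      simp
  rw [← ZMod.natCast_eq_one_iff_odd] at hodd ⊢
  rw [← hodd, h1, Nat.cast_add, Nat.cast_sum univ (fun v => ∑ i : Fin (2 * n v), _),
    sum_eq_zero fun v _ => h2 v, add_zero, card_filter, Nat.cast_sum, Nat.cast_sum]
  refine sum_congr rfl fun e _ => ?_
  by_cases h3 : Sum.inl (e, true) ∈ C <;> by_cases h4 : Sum.inl (e, false) ∈ C <;>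
    simp [h3, h4]
  rfl

end

end SignedGraph

/-! ### Odd sets, perfect matchings and edge sets with prescribed boundary -/

namespace SignedGraph

variable {V E : Type*} [Fintype V] [DecidableEq V] [Fintype E] {inc : E × Bool → V}
  {t : E × Bool → Bool} {n : V → ℕ}

/-- If `C` splits the core at some vertex, the complete bipartite graph there already contributes 1.
Otherwise the number of edges split by `C` is odd. Three of them contribute 3 * 1/3. A single one
contributes 1/3, and the remaining 2/3 come from a vertex whose gadget is only partly in `C`; there
is one, since otherwise `C` would come from an edge cut of size one. -/
theorem one_le_sum_gadgetEdgeWeight [DecidableEq (GadgetVertex E n)]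
    (hn : ∀ v, #{h | inc h = v ∧ t h = true} = #{h | inc h = v ∧ t h = false} + 3 * n v)
    (hX : ∀ (X : Set V) (e : E), ¬ (inc (e, true) ∈ X ↔ inc (e, false) ∈ X) →
      ∃ e', e' ≠ e ∧ ¬ (inc (e', true) ∈ X ↔ inc (e', false) ∈ X))
    {C U : Finset (GadgetVertex E n)} (hd : Disjoint C U) (hodd : Odd C.card)
    (hcl : ∀ y ∈ C, ∀ z, z ∉ U → (gadget inc t n).Adj y z → z ∈ C) :
    1 ≤ ∑ y ∈ C, ∑ z ∈ U, gadgetEdgeWeight inc t n y z := by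
  classical
  let β := gadgetWeight (E := E) n
  let m := sideMass (gadgetLoc inc n) (gadgetSide t n) β
  let W := gadgetTotal inc t
  have hβ : ∀ y, 2 / 3 ≤ β y := gadgetWeight_ge n
  have hβ0 : ∀ y, 0 ≤ β y := gadgetWeight_nonneg n
  have hm0 : ∀ F v s, 0 ≤ m F v s := fun F v s => sideMass_nonneg hβ0 F v s
  have hW0 : ∀ v, 0 ≤ W v := fun v => gadgetTotal_nonneg v
  -- A vertex of `C` is adjacent to the whole opposite side at its position, so that side lies in `C
  -- ∪ U`.
  have hopp : ∀ v s, 0 < m C v s → m C v (!s) + m U v (!s) = W v := by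
    intro v s h
    obtain ⟨y, hy, h1, h2⟩ := exists_of_sideMass_pos h
    refine (sideMass_add_eq hd fun z hz1 hz2 => ?_).trans (sideMass_gadget hn v (!s))
    by_contra! hz
    exact hz.1 (hcl y hy z hz.2 (Or.inr ⟨h1.trans hz1.symm, by rw [h2, hz2]; simp⟩))
  set gad : V → ℚ := fun v => (m C v true * m U v false + m C v false * m U v true) / W v
    with hgad
  have hgad0 : ∀ v, 0 ≤ gad v := fun v =>
    div_nonneg (add_nonneg (mul_nonneg (hm0 _ _ _) (hm0 _ _ _))
      (mul_nonneg (hm0 _ _ _) (hm0 _ _ _))) (hW0 v)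
  set cut : Finset E := {e : E | ¬ (Sum.inl (e, true) ∈ C ↔ Sum.inl (e, false) ∈ C)} with hcut
  have hmate : 1 / 3 * (cut.card : ℚ) ≤
      ∑ y ∈ C, ∑ z ∈ U, (if GadgetMate n y z then (1 / 3 : ℚ) else 0) := by
    rw [sum_mate, hcut, card_filter, Nat.cast_sum, mul_sum]
    refine sum_le_sum fun e _ => ?_
    have hU : ∀ b, (Sum.inl (e, b) : GadgetVertex E n) ∈ C → .inl (e, !b) ∉ C →
        .inl (e, !b) ∈ U := by
      intro b h1 h2
      by_contra h3
      exact h2 (hcl _ h1 _ h3 (Or.inl rfl))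
    have hUt := hU true
    have hUf := hU false
    simp only [Bool.not_true, Bool.not_false] at hUt hUf
    by_cases h3 : (Sum.inl (e, true) : GadgetVertex E n) ∈ C <;>
      by_cases h4 : (Sum.inl (e, false) : GadgetVertex E n) ∈ C
    · simp only [h3, h4, true_and]
      simp
      split_ifs <;> norm_num
    · simp [h3, h4, hUt h3 h4]
    · simp [h3, h4, hUf h4 h3]
    · simp [h3, h4]
  have hsum : 1 / 3 * (cut.card : ℚ) + ∑ v, gad v ≤
      ∑ y ∈ C, ∑ z ∈ U, gadgetEdgeWeight inc t n y z := by
    unfold gadgetEdgeWeight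
    simp only [sum_add_distrib]
    rw [sum_sum_bipartite]
    exact add_le_add hmate le_rfl
  refine le_trans ?_ hsum
  by_cases hcore : ∀ v (i j : Fin (2 * n v)),
      (.inr ⟨v, i⟩ : GadgetVertex E n) ∈ C → (.inr ⟨v, j⟩ : GadgetVertex E n) ∈ C
  · have hk : Odd cut.card := by
      convert odd_card_cut hodd hcore
    by_cases hk3 : 3 ≤ cut.card
    · have h1 : (3 : ℚ) ≤ cut.card := by exact_mod_cast hk3
      have h2 : 0 ≤ ∑ v, gad v := sum_nonneg fun v _ => hgad0 v
      linarith
    have hk1 : cut.card = 1 := by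
      obtain ⟨r, hr⟩ := hk
      omega
    by_contra! hlt
    rw [hk1] at hlt
    have hfull : ∀ y z : GadgetVertex E n, gadgetLoc inc n y = gadgetLoc inc n z → y ∈ C →
        z ∈ C := by
      intro y z hyz hy
      by_contra hz
      have hWz := gadgetTotal_pos hn z
      have h1 : 2 / 3 ≤ gad (gadgetLoc inc n z) := by
        rw [hgad, le_div_iff₀ hWz]
        refine le_bipartite_cut_of_proper (sideMass_eq_zero_or_le hβ _ _ _)
          (sideMass_eq_zero_or_le hβ _ _ _) (sideMass_eq_zero_or_le hβ _ _ _)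
          (sideMass_eq_zero_or_le hβ _ _ _) (hopp _ false) (hopp _ true) ?_ ?_
        · have h2 : β y ≤ m C (gadgetLoc inc n y) (gadgetSide t n y) := le_sideMass hβ0 hy
          have h3 := hβ y
          rw [hyz] at h2
          cases h4 : gadgetSide t n y <;> rw [h4] at h2
          · right; linarith
          · left; linarith
        · intro h5 h6
          have h2 : m C (gadgetLoc inc n z) (gadgetSide t n z) + β z ≤
              sideMass (gadgetLoc inc n) (gadgetSide t n) β univ (gadgetLoc inc n z)
              (gadgetSide t n z) :=
            sideMass_add_le hβ0 hz
          have h3 := hβ z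
          have h7 := sideMass_gadget hn (gadgetLoc inc n z) (gadgetSide t n z)
          change sideMass _ _ β univ _ _ = _ at h7
          change m C _ _ = _ at h5 h6
          rw [h7] at h2
          cases h4 : gadgetSide t n z <;> rw [h4] at h2 <;> linarith
      have h2 := single_le_sum (f := gad) (fun v _ => hgad0 v) (mem_univ (gadgetLoc inc n z))
      push_cast at hlt
      linarith
    let X : Set V := {v | ∃ y ∈ C, gadgetLoc inc n y = v}
    have hXC : ∀ h : E × Bool, inc h ∈ X ↔ .inl h ∈ C := by
      intro h
      refine ⟨?_, fun hh => ⟨_, hh, rfl⟩⟩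
      rintro ⟨y, hy, hyh⟩
      exact hfull y (.inl h) hyh hy
    obtain ⟨e, he⟩ := card_eq_one.1 hk1
    have hecut : ∀ e', e' ∈ cut ↔ ¬ (inc (e', true) ∈ X ↔ inc (e', false) ∈ X) := by
      intro e'
      rw [hXC, hXC]
      simp [hcut]
    obtain ⟨e', hne, he'⟩ := hX X e ((hecut e).1 (by simp [he]))
    rw [← hecut, he, mem_singleton] at he'
    exact hne he'
  · push Not at hcore
    obtain ⟨v, i, j, hi, hj⟩ := hcore
    have hWv : 0 < W v := gadgetTotal_pos hn (.inr ⟨v, i⟩)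
    have h1 : 1 ≤ gad v := by
      rw [hgad, le_div_iff₀ hWv, one_mul]
      have hone : ∀ k, β (.inr k) = 1 := fun _ => rfl
      have hb : β (.inr ⟨v, i⟩) ≤ m C v false :=
        le_sideMass (loc := gadgetLoc inc n) (side := gadgetSide t n) (y := .inr ⟨v, i⟩) hβ0 hi
      have hb1 : m C v false + β (.inr ⟨v, j⟩) ≤ m univ v false :=
        sideMass_add_le (loc := gadgetLoc inc n) (side := gadgetSide t n) (y := .inr ⟨v, j⟩) hβ0 hj
      rw [hone] at hb hb1
      have hb2 : m univ v false = W v := sideMass_gadget hn v false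
      have hb' : m C v false + 1 ≤ W v := hb1.trans_eq hb2
      exact le_bipartite_cut_of_split (by linarith) (hm0 _ _ _) (hm0 _ _ _) hb hb'
        (hopp v false (by linarith)) (hopp v true)
    have h2 := single_le_sum (f := gad) (fun v _ => hgad0 v) (mem_univ v)
    have h3 : (0 : ℚ) ≤ cut.card := by positivity
    linarith

theorem exists_isPerfectMatching_gadget
    (hn : ∀ v, #{h | inc h = v ∧ t h = true} = #{h | inc h = v ∧ t h = false} + 3 * n v)
    (hX : ∀ (X : Set V) (e : E), ¬ (inc (e, true) ∈ X ↔ inc (e, false) ∈ X) →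
      ∃ e', e' ≠ e ∧ ¬ (inc (e', true) ∈ X ↔ inc (e', false) ∈ X)) :
    ∃ M : (gadget inc t n).Subgraph, M.IsPerfectMatching := by
  classical
  exact SimpleGraph.exists_isPerfectMatching_of_weight _ (gadgetEdgeWeight inc t n)
    gadgetEdgeWeight_nonneg (sum_gadgetEdgeWeight hn)
    fun C U hd hodd hcl => one_le_sum_gadgetEdgeWeight hn hX hd hodd hcl

/-- In a bidirected graph without cuts of size one whose boundary is three times `n`, some set of
edges has boundary `n`. -/
theorem exists_finset_boundary_eq
    (hn : ∀ v, #{h | inc h = v ∧ t h = true} = #{h | inc h = v ∧ t h = false} + 3 * n v)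
    (hX : ∀ (X : Set V) (e : E), ¬ (inc (e, true) ∈ X ↔ inc (e, false) ∈ X) →
      ∃ e', e' ≠ e ∧ ¬ (inc (e', true) ∈ X ↔ inc (e', false) ∈ X)) :
    ∃ S : E → Prop, ∀ v, Nat.card {h // (inc h = v ∧ t h = true) ∧ S h.1} =
      Nat.card {h // (inc h = v ∧ t h = false) ∧ S h.1} + n v := by
  classical
  obtain ⟨M, hM⟩ := exists_isPerfectMatching_gadget hn hX
  rw [SimpleGraph.Subgraph.isPerfectMatching_iff] at hM
  let S : E → Prop := fun e => M.Adj (.inl (e, false)) (.inl (e, true))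
  have hS : ∀ e b, M.Adj (.inl (e, b)) (.inl (e, !b)) ↔ S e := by
    rintro e (_ | _)
    · rfl
    · exact M.adj_comm _ _
  refine ⟨S, fun v => ?_⟩
  choose f hf hfu using hM
  have hff : ∀ y, f (f y) = y := fun y => (hfu (f y) y (hf y).symm).symm
  have hfmate : ∀ e b, f (.inl (e, b)) = .inl (e, !b) ↔ S e := by
    intro e b
    rw [← hS e b]
    exact ⟨fun h => h ▸ hf _, fun h => (hfu _ _ h).symm⟩
  -- Free vertices are those not covered by a matched mate pair. The matching pairs them across the
  -- two sides at each position, so free half-edges have surplus `2 * n v` there. Subtracting this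
  -- from `3 * n v` leaves `n v` for `S`.
  let free : GadgetVertex E n → Prop := Sum.elim (fun h => ¬ S h.1) fun _ => True
  have hfree : ∀ y, free y → free (f y) ∧ gadgetLoc inc n (f y) = gadgetLoc inc n y ∧
      gadgetSide t n (f y) = !gadgetSide t n y := by
    intro y hy
    have hnm : ¬ GadgetMate n y (f y) := by
      intro h
      rcases y with ⟨e, b⟩ | y
      · rcases hz : f (.inl (e, b)) with z | z
        · rw [hz] at h
          have h' : z = (e, !b) := h
          subst h'
          exact hy ((hfmate e b).1 hz)
        · rw [hz] at h
          exact h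
      · exact h
    refine ⟨?_, ?_⟩
    · rcases hz : f y with ⟨e, b⟩ | z
      · intro hSe
        have h1 := (hfmate e b).2 hSe
        rw [← hz, hff] at h1
        subst h1
        exact hy hSe
      · trivial
    · rcases M.adj_sub (hf y) with h | ⟨h1, h2⟩
      · exact (hnm h).elim
      · refine ⟨h1.symm, ?_⟩
        cases h3 : gadgetSide t n y <;> cases h4 : gadgetSide t n (f y) <;> simp_all
  have hbij : #{y | free y ∧ gadgetLoc inc n y = v ∧ gadgetSide t n y = true} =
      #{y | free y ∧ gadgetLoc inc n y = v ∧ gadgetSide t n y = false} := by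
    refine card_bij' (fun y _ => f y) (fun y _ => f y) ?_ ?_ (fun y _ => hff y) fun y _ => hff y
    all_goals
      intro y hy
      simp only [mem_filter, mem_univ, true_and] at hy ⊢
      obtain ⟨h1, h2, h3⟩ := hfree y hy.1
      exact ⟨h1, h2.trans hy.2.1, by rw [h3, hy.2.2]; rfl⟩
  have hT : #{y | free y ∧ gadgetLoc inc n y = v ∧ gadgetSide t n y = true} =
      #{h : E × Bool | (inc h = v ∧ t h = true) ∧ ¬ S h.1} := by
    rw [card_filter, Fintype.sum_sum_type, card_filter]
    simp [free, gadgetLoc, gadgetSide, and_comm, and_assoc]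
  have hF : #{y | free y ∧ gadgetLoc inc n y = v ∧ gadgetSide t n y = false} =
      #{h : E × Bool | (inc h = v ∧ t h = false) ∧ ¬ S h.1} + 2 * n v := by
    rw [card_filter, Fintype.sum_sum_type, card_filter, Fintype.sum_sigma]
    simp [free, gadgetLoc, gadgetSide, and_comm, and_assoc]
  have hsplit : ∀ s, #{h : E × Bool | inc h = v ∧ t h = s} =
      #{h : E × Bool | (inc h = v ∧ t h = s) ∧ S h.1} +
      #{h : E × Bool | (inc h = v ∧ t h = s) ∧ ¬ S h.1} := by
    intro s
    rw [← card_filter_add_card_filter_not (fun h : E × Bool => S h.1), filter_filter,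
      filter_filter]
  have h1 := hn v
  rw [hsplit, hsplit] at h1
  rw [Nat.card_eq_fintype_card, Nat.card_eq_fintype_card, Fintype.card_subtype,
    Fintype.card_subtype]
  omega

end SignedGraph

/-! ### Integer flows and the treatment of cut-edges -/

namespace SignedGraph

variable {V E : Type*}

/-- In a bidirected graph without cuts of size one whose boundary is divisible by three, there is
an integer flow with values in `{1, -2}`. -/
theorem exists_flow_one_neg_two [Fintype V] [DecidableEq V] [Fintype E] {inc : E × Bool → V}
    (τ : E × Bool → ℤˣ) (h3 : ∀ v, (3 : ℤ) ∣ ∑ h with inc h = v, (τ h : ℤ))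
    (hX : ∀ (X : Set V) (e : E), ¬ (inc (e, true) ∈ X ↔ inc (e, false) ∈ X) →
      ∃ e', e' ≠ e ∧ ¬ (inc (e', true) ∈ X ↔ inc (e', false) ∈ X)) :
    ∃ y : E → ℤ, (∀ e, y e = 1 ∨ y e = -2) ∧
      ∀ v, ∑ h with inc h = v, (τ h : ℤ) * y h.1 = 0 := by
  classical
  choose d hd using h3
  -- Switching at the vertices with `d v < 0` makes the boundary nonnegative, as the gadget
  -- requires.
  let s : V → ℤˣ := fun v => if 0 ≤ d v then 1 else -1
  let t : E × Bool → Bool := fun h => decide (τ h = s (inc h))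
  have hτ : ∀ h, (τ h : ℤ) = s (inc h) * if t h = true then 1 else -1 := by
    intro h
    rcases Int.units_eq_one_or (τ h) with h1 | h1 <;>
      rcases Int.units_eq_one_or (s (inc h)) with h2 | h2 <;> simp [t, h1, h2]
  have hsum : ∀ (S : E → Prop) v, ∑ h with inc h = v, (τ h : ℤ) * (if S h.1 then 1 else 0) =
      s v * ((#{h | (inc h = v ∧ t h = true) ∧ S h.1} : ℤ) -
        #{h | (inc h = v ∧ t h = false) ∧ S h.1}) := by
    intro S v
    rw [card_filter, card_filter, sum_filter]
    push_cast
    rw [← sum_sub_distrib, mul_sum]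
    refine sum_congr rfl fun h _ => ?_
    by_cases h1 : inc h = v
    · rw [if_pos h1, hτ h, h1]
      by_cases h2 : t h = true <;> by_cases h4 : S h.1 <;> simp [h2, h4]
    · simp [h1]
  have hsd : ∀ v, d v = s v * ((d v).natAbs : ℤ) := by
    intro v
    by_cases h : 0 ≤ d v
    · simp [s, h, abs_of_nonneg h]
    · simp only [s, h, if_false]
      push_cast
      rw [abs_of_neg (not_le.1 h)]
      ring
  have hss : ∀ v, (s v : ℤ) * s v = 1 := fun v => by
    rw [← Units.val_mul, Int.units_mul_self, Units.val_one]
  have hcancel : ∀ v (a b : ℤ), s v * a = s v * b → a = b := by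
    intro v a b h
    rw [← one_mul a, ← hss v, mul_assoc, h, ← mul_assoc, hss, one_mul]
  have hn : ∀ v, #{h | inc h = v ∧ t h = true} =
      #{h | inc h = v ∧ t h = false} + 3 * (d v).natAbs := by
    intro v
    have h1 := hsum (fun _ => True) v
    simp only [if_true, mul_one, and_true] at h1
    rw [hd v, hsd v] at h1
    have h2 := hcancel v (3 * (d v).natAbs) _ (by rw [← h1]; ring)
    omega
  obtain ⟨S, hS⟩ := exists_finset_boundary_eq (n := fun v => (d v).natAbs) hn hX
  refine ⟨fun e => 1 - 3 * (if S e then 1 else 0), fun e => ?_, fun v => ?_⟩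
  · by_cases h : S e <;> simp [h]
  · have h1 := hS v
    rw [Nat.card_eq_fintype_card, Nat.card_eq_fintype_card, Fintype.card_subtype,
      Fintype.card_subtype] at h1
    have h2 := hsum S v
    rw [h1] at h2
    push_cast at h2
    have h4 := hsd v
    push_cast at h4
    simp only [mul_sub, mul_one, sum_sub_distrib, hd v, mul_left_comm _ (3 : ℤ), ← mul_sum]
    rw [h2]
    linear_combination 3 * h4

theorem mem_cutEdges_of_cut (G : SignedGraph V E) {X : Set V} {e : E}
    (he : ¬ (G.inc (e, true) ∈ X ↔ G.inc (e, false) ∈ X))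
    (hX : ∀ e', e' ≠ e → (G.inc (e', true) ∈ X ↔ G.inc (e', false) ∈ X)) : e ∈ G.cutEdges := by
  intro hpath
  have key : ∀ v, Relation.ReflTransGen (G.AdjAvoiding e) (G.inc (e, false)) v →
      (v ∈ X ↔ G.inc (e, false) ∈ X) := by
    intro v hv
    induction hv with
    | refl => rfl
    | tail _ hbc ih =>
      obtain ⟨e', b, hne, rfl, rfl⟩ := hbc
      rw [← ih]
      cases b
      exacts [hX e' hne, (hX e' hne).symm]
  exact he (key _ hpath)

/-- Sum the flow equations modulo 2, where orientations disappear, over the vertices reachable from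
one end without `e`. Every other edge counts twice or not at all, so only `g e` remains. -/
theorem even_of_mem_cutEdges [Fintype V] [DecidableEq V] [Fintype E] (G : SignedGraph V E)
    {τ : E × Bool → ℤˣ} {g : E → ℤ} (hg : ∀ v, ∑ h with G.inc h = v, (τ h : ℤ) * g h.1 = 0)
    {e : E} (he : e ∈ G.cutEdges) : Even (g e) := by
  classical
  let X : Set V := {v | Relation.ReflTransGen (G.AdjAvoiding e) (G.inc (e, false)) v}
  have hX0 : G.inc (e, false) ∈ X := Relation.ReflTransGen.refl
  have hX1 : G.inc (e, true) ∉ X := he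
  have hX : ∀ e', e' ≠ e → (G.inc (e', true) ∈ X ↔ G.inc (e', false) ∈ X) := fun e' hne =>
    ⟨fun h => Relation.ReflTransGen.tail h ⟨e', true, hne, rfl, rfl⟩,
      fun h => Relation.ReflTransGen.tail h ⟨e', false, hne, rfl, rfl⟩⟩
  have h1 : ∑ h, (if G.inc h ∈ X then (τ h : ℤ) * g h.1 else 0) = 0 := by
    have h2 : ∑ v, ∑ h, (if v ∈ X then (if G.inc h = v then (τ h : ℤ) * g h.1 else 0) else 0) =
        0 := by
      refine sum_eq_zero fun v _ => ?_
      by_cases hv : v ∈ X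
      · simp only [hv, if_true, ← sum_filter, hg v]
      · simp [hv]
    refine Eq.trans ?_ h2
    rw [sum_comm]
    refine sum_congr rfl fun h _ => ?_
    rw [sum_eq_single (G.inc h)]
    · simp
    · intro v _ hv
      simp [hv.symm]
    · simp
  have h2 := congrArg (Int.cast : ℤ → ZMod 2) h1
  have hτ : ∀ h, ((τ h : ℤ) : ZMod 2) = 1 := by
    intro h
    rcases Int.units_eq_one_or (τ h) with h | h <;> rw [h] <;> rfl
  rw [Fintype.sum_prod_type, Int.cast_sum, sum_eq_single e] at h2
  · simpa [hX0, hX1, hτ, ZMod.intCast_zmod_eq_zero_iff_dvd, even_iff_two_dvd,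
      ZMod.intCast_eq_zero_iff_even] using h2
  · intro e' _ hne
    by_cases h : G.inc (e', false) ∈ X
    · simp [h, (hX e' hne).2 h, hτ, CharTwo.add_self_eq_zero]
    · simp [h, mt (hX e' hne).1 h]
  · simp

/-- The sign of a parallel copy of an edge. -/
def copySign {k : ℕ} (i : Fin k) : ℤˣ := if i.val = 2 then -1 else 1

/-- Lets a flow on the graph of copies be pulled back to `G` as the signed sum over the copies of
each edge. For `y = 1` it shows that the boundary is unchanged, since 1 + 1 - 1 = 1. -/
theorem sum_copies [DecidableEq V] [Fintype E] (G : SignedGraph V E) (τ : E × Bool → ℤˣ)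
    (m : E → ℕ) (y : (Σ e, Fin (m e)) → ℤ) (v : V) :
    ∑ h : (Σ e, Fin (m e)) × Bool with G.inc (h.1.1, h.2) = v,
        ((τ (h.1.1, h.2) * copySign h.1.2 : ℤˣ) : ℤ) * y h.1 =
      ∑ h with G.inc h = v, (τ h : ℤ) * ∑ i, (copySign i : ℤ) * y ⟨h.1, i⟩ := by
  rw [sum_filter, sum_filter, Fintype.sum_prod_type, Fintype.sum_prod_type, Fintype.sum_sigma]
  refine sum_congr rfl fun e _ => ?_
  rw [sum_comm]
  refine sum_congr rfl fun b _ => ?_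
  by_cases h : G.inc (e, b) = v
  · simp only [h, if_true, mul_sum]
    refine sum_congr rfl fun i _ => ?_
    push_cast
    ring
  · simp [h]

/-- A bidirected graph whose boundary is divisible by three has a flow with values in `{1, -2}`
outside of the cut-edges and in `{-2, 4}` on the cut-edges. -/
theorem exists_flow_of_three_dvd [Fintype V] [DecidableEq V] [Fintype E] (G : SignedGraph V E)
    (τ : E × Bool → ℤˣ) (h3 : ∀ v, (3 : ℤ) ∣ ∑ h with G.inc h = v, (τ h : ℤ)) :
    ∃ g : E → ℤ, (∀ v, ∑ h with G.inc h = v, (τ h : ℤ) * g h.1 = 0) ∧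
      ∀ e, g e = 1 ∨ g e = -2 ∨ (g e = 4 ∧ e ∈ G.cutEdges) := by
  classical
  let m : E → ℕ := fun e => if e ∈ G.cutEdges then 3 else 1
  have hmpos : ∀ e, 0 < m e := fun e => by by_cases h : e ∈ G.cutEdges <;> simp [m, h]
  have hone : ∀ k, k = 3 ∨ k = 1 → ∑ i : Fin k, (copySign i : ℤ) = 1 := by
    rintro k (rfl | rfl)
    · rw [Fin.sum_univ_three]; rfl
    · rw [Fin.sum_univ_one]; rfl
  have hm : ∀ e, m e = 3 ∨ m e = 1 := fun e => by by_cases h : e ∈ G.cutEdges <;> simp [m, h]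
  obtain ⟨y, hy, hy0⟩ := exists_flow_one_neg_two
    (inc := fun h : (Σ e, Fin (m e)) × Bool => G.inc (h.1.1, h.2))
    (fun h => τ (h.1.1, h.2) * copySign h.1.2) (fun v => by
      have := sum_copies G τ m (fun _ => 1) v
      simp only [mul_one, hone _ (hm _)] at this
      rw [this]
      exact h3 v) (by
      rintro X ⟨e, i⟩ he
      by_contra! hcon
      -- A cut consisting of a single copy would come from a cut-edge of `G`, but the other copies
      -- of a cut-edge cross the same cut.
      have hcut : e ∈ G.cutEdges := mem_cutEdges_of_cut G he fun e' hne =>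
        hcon ⟨e', ⟨0, hmpos e'⟩⟩ fun h => hne (congrArg Sigma.fst h)
      have hm3 : m e = 3 := if_pos hcut
      have : Nontrivial (Fin (m e)) := by rw [hm3]; infer_instance
      obtain ⟨j, hj⟩ := exists_ne i
      exact he (hcon ⟨e, j⟩ (by simpa using hj)))
  simp only [sum_copies] at hy0
  refine ⟨fun e => ∑ i, (copySign i : ℤ) * y ⟨e, i⟩, hy0, fun e => ?_⟩
  have heven := fun he : e ∈ G.cutEdges =>
    even_of_mem_cutEdges G (g := fun e => ∑ i, (copySign i : ℤ) * y ⟨e, i⟩) hy0 he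
  by_cases he : e ∈ G.cutEdges
  · have hval : ∀ k (z : Fin k → ℤ), k = 3 → (∀ i, z i = 1 ∨ z i = -2) →
        Even (∑ i, (copySign i : ℤ) * z i) →
        ∑ i, (copySign i : ℤ) * z i = -2 ∨ ∑ i, (copySign i : ℤ) * z i = 4 := by
      rintro k z rfl hz
      rw [Fin.sum_univ_three]
      have h0 : (copySign (0 : Fin 3) : ℤ) = 1 := rfl
      have h1 : (copySign (1 : Fin 3) : ℤ) = 1 := rfl
      have h2 : (copySign (2 : Fin 3) : ℤ) = -1 := rfl
      rw [h0, h1, h2]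
      rintro ⟨r, hr⟩
      rcases hz 0 with h0 | h0 <;> rcases hz 1 with h1 | h1 <;> rcases hz 2 with h2 | h2 <;>
        rw [h0, h1, h2] at hr ⊢ <;> omega
    rcases hval (m e) (fun i => y ⟨e, i⟩) (if_pos he) (fun i => hy _) (heven he) with h | h
    · exact Or.inr (Or.inl h)
    · exact Or.inr (Or.inr ⟨h, he⟩)
  · have hval : ∀ k (z : Fin k → ℤ), k = 1 → (∀ i, z i = 1 ∨ z i = -2) →
        ∑ i, (copySign i : ℤ) * z i = 1 ∨ ∑ i, (copySign i : ℤ) * z i = -2 := by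
      rintro k z rfl hz
      rw [Fin.sum_univ_one]
      have h0 : (copySign (0 : Fin 1) : ℤ) = 1 := rfl
      rw [h0, one_mul]
      exact hz 0
    rcases hval (m e) (fun i => y ⟨e, i⟩) (if_neg he) (fun i => hy _) with h | h
    · exact Or.inl h
    · exact Or.inr (Or.inl h)

end SignedGraph

theorem mainTheorem5 {V E : Type*} [Fintype V] [DecidableEq V] [Fintype E]
    (G : SignedGraph V E)
    (h : ∃ (τ : E × Bool → ℤˣ) (f : E → ZMod 3), G.IsNZF τ f) :
    ∃ (τ : E × Bool → ℤˣ) (g : E → ℤ), G.IsIntNZF 5 τ g ∧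
      SignedGraph.edgesOfAbs g 3 = ∅ ∧
      SignedGraph.edgesOfAbs g 4 ⊆ G.cutEdges := by
  obtain ⟨τ₀, f, ⟨hτ₀, hf⟩, hf0⟩ := h
  -- Both half-edges are reversed together, so `τ` is an orientation for the same signature.
  let τ : E × Bool → ℤˣ := fun h => τ₀ h * if f h.1 = 1 then 1 else -1
  have hmod : ∀ h, ((τ h : ℤ) : ZMod 3) = (τ₀ h : ℤ) • f h.1 := by
    intro h
    have h1 : f h.1 = 1 ∨ f h.1 = -1 := by
      have := hf0 h.1
      generalize f h.1 = a at this
      revert a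
      decide
    rcases h1 with h1 | h1
    · simp [τ, h1]
    · have h2 : (-1 : ZMod 3) ≠ 1 := by decide
      simp [τ, h1, h2]
  obtain ⟨g, hg, hval⟩ := G.exists_flow_of_three_dvd τ fun v => by
    have h1 := hf v
    rw [SignedGraph.boundary] at h1
    refine (ZMod.intCast_zmod_eq_zero_iff_dvd _ 3).1 ?_
    rw [Int.cast_sum]
    simpa only [hmod] using h1
  refine ⟨τ, g, ⟨⟨⟨?_, fun v => ?_⟩, fun e => ?_⟩, fun e => ?_⟩, ?_, ?_⟩
  · intro e b
    rw [← hτ₀ e b]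
    change τ₀ (e, b) * _ * (τ₀ (e, !b) * _) = _
    split_ifs <;> simp
  · rw [SignedGraph.boundary]
    simpa only [smul_eq_mul] using hg v
  · rcases hval e with h | h | ⟨h, -⟩ <;> rw [h] <;> norm_num
  · rcases hval e with h | h | ⟨h, -⟩ <;> rw [h] <;> norm_num
  · ext e
    simp only [SignedGraph.edgesOfAbs, Set.mem_ofPred_eq, Set.mem_empty_iff_false, iff_false]
    rcases hval e with h | h | ⟨h, -⟩ <;> rw [h] <;> norm_num
  · intro e he
    simp only [SignedGraph.edgesOfAbs, Set.mem_ofPred_eq] at he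
    rcases hval e with h | h | ⟨h, h'⟩
    · rw [h] at he; norm_num at he
    · rw [h] at he; norm_num at he
    · exact h'
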